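/- For $n\ge 1$, a standard $n$-puzzle is a $2\times(n+1)$ array (top row and bottom row) in which each of the numbers $1,2,\dots,2n+2$ appears exactly once. Its pieces are the $n$ blocks of size $2\times 2$ formed by consecutive columns; the reduction of a piece is obtained by replacing its four distinct entries by $1,2,3,4$, respecting their order. For a set $\mathcal{P}$ of $2\times 2$ arrays with entries $\{1,2,3,4\}$ (standard pieces), let $s_n(\mathcal{P})$ be the number of standard $n$-puzzles such that the reduction of each of their pieces belongs to $\mathcal{P}$. Let $$A_1=\begin{bmatrix}4&3\\1&2\end{bmatrix},\quad A_2=\begin{bmatrix}3&4\\1&2\end{bmatrix},\quad A_3=\begin{bmatrix}2&4\\1&3\end{bmatrix},$$ $$B_1=\begin{bmatrix}4&2\\1&3\end{bmatrix},\; B_2=\begin{bmatrix}3&2\\1&4\end{bmatrix},\; B_3=\begin{bmatrix}2&3\\1&4\end{bmatrix},\; B_4=\begin{bmatrix}3&1\\2&4\end{bmatrix},\; B_5=\begin{bmatrix}4&1\\2&3\end{bmatrix},\; B_6=\begin{bmatrix}4&1\\3&2\end{bmatrix},$$ and let $\mathcal{P}=\{A_1,A_2,A_3\}$. **Theorem.**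 For every integer $n\ge 1$, - $s_n(\mathcal{P}\cup\{B_1\})=s_n(\mathcal{P}\cup\{B_2\})=s_n(\mathcal{P}\cup\{B_3\})=\frac43\,(2n+1)!!$; - $s_n(\mathcal{P}\cup\{B_4\})=s_n(\mathcal{P}\cup\{B_5\})=2^n\,(n+1)!$; - $s_n(\mathcal{P}\cup\{B_6\})=(n+3)\,(2n+1)!!-(2n+2)!!$. Here $m!!=m(m-2)(m-4)\cdots$ denotes the double factorial, the product ending in $1$ or $2$. -/

import Mathlib

open scoped Nat

namespace StandardPuzzle

/-- A row of `n` square pieces has `2 (n + 1)` vertices. It is recorded by the two-row matrix of its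
labels (row `0` is the top row, row `1` the bottom row); the `k`-th piece occupies the columns `k`
and `k + 1`. It is a standard `n`-puzzle if the set of its labels is `{1, …, m}`, where
`m = 2 n + 2` is the number of its vertices. -/
def IsStandardPuzzle {n : ℕ} (α : Matrix (Fin 2) (Fin (n + 1)) ℕ) : Prop :=
  Set.range (fun v : Fin 2 × Fin (n + 1) => α v.1 v.2) = Set.Icc 1 (2 * n + 2)

/-- A piece: a square with a label on each of its four corners. -/
abbrev Piece := Matrix (Fin 2) (Fin 2) ℕ

/-- The `k`-th piece of a row of `n` pieces. -/
def pieceAt {n : ℕ} (α : Matrix (Fin 2) (Fin (n + 1)) ℕ) (k : Fin n) : Piece :=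
  !![α 0 k.castSucc, α 0 k.succ;
     α 1 k.castSucc, α 1 k.succ]

/-- The reduction of a piece: each label is replaced by its rank among the labels of the piece
(for distinct labels, this replaces them by `1, 2, 3, 4`, respecting their order). -/
def reduction (M : Piece) : Piece :=
  Matrix.of fun i j => (Finset.univ.filter fun v : Fin 2 × Fin 2 => M v.1 v.2 ≤ M i j).card

/-- The set `P` is a support of the puzzle `α`. -/
def IsSupport {n : ℕ} (P : Set Piece) (α : Matrix (Fin 2) (Fin (n + 1)) ℕ) : Prop :=
  ∀ k : Fin n, reduction (pieceAt α k) ∈ P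

/-- `S_n(P)`: the set of the standard `n`-puzzles that have `P` as a support. -/
def S (n : ℕ) (P : Set Piece) : Set (Matrix (Fin 2) (Fin (n + 1)) ℕ) :=
  {α | IsStandardPuzzle α ∧ IsSupport P α}

/-- `s_n(P)`: the cardinality of the (finite) set `S_n(P)`. -/
noncomputable def s (n : ℕ) (P : Set Piece) : ℕ := (S n P).ncard

theorem S_finite (n : ℕ) (P : Set Piece) : (S n P).Finite := by
  have h : (Set.univ.pi fun _ : Fin 2 => Set.univ.pi fun _ : Fin (n + 1) =>
      Set.Icc 1 (2 * n + 2)).Finite :=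
    Set.Finite.pi fun _ => Set.Finite.pi fun _ => Set.finite_Icc _ _
  refine h.subset ?_
  rintro α ⟨hα, -⟩ i - j -
  rw [← hα]
  exact ⟨(i, j), rfl⟩

/-- The standard pieces `A₁, A₂, A₃` and `B₁, …, B₆`. -/
def A₁ : Piece := !![4, 3; 1, 2]
def A₂ : Piece := !![3, 4; 1, 2]
def A₃ : Piece := !![2, 4; 1, 3]
def B₁ : Piece := !![4, 2; 1, 3]
def B₂ : Piece := !![3, 2; 1, 4]
def B₃ : Piece := !![2, 3; 1, 4]
def B₄ : Piece := !![3, 1; 2, 4]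
def B₅ : Piece := !![4, 1; 2, 3]
def B₆ : Piece := !![4, 1; 3, 2]

end StandardPuzzle

/-!
Write a column as the pair `(b, t)` of its bottom and top labels. A piece with columns `(b, t)` and
`(b', t')` reduces to one of `A₁, A₂, A₃` exactly when `b < t`, `b < b'` and `b' < t'`. Each of
`B₁, …, B₆` has `b < t` but `t' < b'`, so none of them can be followed by an admissible piece: a
piece `Bᵢ` occurs at most once, at the right end (`s_eq_ncard_endingIn`). With `n = m + 1`, let
`e(X)` be the number of standard labellings whose first `m` columns satisfy `b < t` and `b < b'`,
where `b'` is the next bottom label, and whose last piece reduces to `X`. Then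
`s_n(P ∪ {Bᵢ}) = e(A₁) + e(A₂) + e(A₃) + e(Bᵢ)`.

The counting tool is a greedy argument (`exists_finset_sortedFront`). Suppose that, apart from
labels fixed beforehand in the last two columns, every bottom label of the first `m` columns has to
be smaller than the top label above it and than all labels to its right, and that the `k` remaining
labels of the last two columns have a prescribed order with minimum at the bottom left. Then the
bottom label of the first column is forced to be the minimum, its top label is arbitrary among the
others, and induction gives `∏_{i < m} (2 i + k + 1)` labellings. It is used in three ways.

* With `k = 4`: the pieces `A₁, A₂, A₃, B₁, B₂, B₃` have their minimum at the bottom left, so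
  `e(X) = ∏ (2 i + 5) = (2 n + 1)‼ / 3` for each of them.
* With `k = 3`, the last top label being chosen freely beforehand: `b < t < b'` describes the pieces
  `A₃, B₂, B₃, B₄` and `b < b' < t` the pieces `A₁, A₂, B₁, B₅`, so each of these quadruples
  has `(2 n + 2) ∏ (2 i + 4) = 2 ^ n (n + 1)!` labellings. As `e` takes the same value on the six
  pieces of the first item, these are also `s_n(P ∪ {B₄})` and `s_n(P ∪ {B₅})`.
* With `k = 2`, the last column being chosen beforehand with `t' < b'`: the condition `b < t`
  then describes `B₁, …, B₆`, so `e(B₁) + ⋯ + e(B₆) = (n + 1) (2 n + 1)‼`, which yields `e(B₆)`.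
-/

namespace StandardPuzzle

/-! ### Labellings with a sorted front -/

/-- A column of a puzzle, recorded as (bottom label, top label). -/
abbrev Column := ℕ × ℕ

/-- The left column of the last piece. -/
def lastL {m : ℕ} (c : Fin (m + 2) → Column) : Column := c (Fin.last m).castSucc

/-- The right column of the last piece, that is, the last column. -/
def lastR {m : ℕ} (c : Fin (m + 2) → Column) : Column := c (Fin.last (m + 1))

/-- The multiset of the labels of all columns but the last two. -/
def frontLabels {m : ℕ} (c : Fin (m + 2) → Column) : Multiset ℕ :=
  ∑ j : Fin m, {(c j.castSucc.castSucc).1, (c j.castSucc.castSucc).2}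

/-- In each column but the last two, the bottom label is smaller than the top label and than the
next bottom label. -/
def FrontSorted {m : ℕ} (c : Fin (m + 2) → Column) : Prop :=
  ∀ j : Fin m, (c j.castSucc.castSucc).1 < (c j.castSucc.castSucc).2 ∧
    (c j.castSucc.castSucc).1 < (c j.succ.castSucc).1

section Cons

variable {m : ℕ} (x : Column) (c : Fin (m + 2) → Column)

theorem lastL_cons : lastL (Fin.cons x c : Fin (m + 1 + 2) → Column) = lastL c := rfl

theorem lastR_cons : lastR (Fin.cons x c : Fin (m + 1 + 2) → Column) = lastR c := rfl

theorem frontLabels_cons :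
    frontLabels (Fin.cons x c : Fin (m + 1 + 2) → Column) = {x.1, x.2} + frontLabels c := by
  unfold frontLabels
  rw [Fin.sum_univ_succ]
  rfl

theorem frontSorted_cons :
    FrontSorted (Fin.cons x c : Fin (m + 1 + 2) → Column) ↔
      x.1 < x.2 ∧ x.1 < (c 0).1 ∧ FrontSorted c := by
  unfold FrontSorted
  rw [Fin.forall_fin_succ, ← and_assoc]
  rfl

end Cons

theorem head_mem {m : ℕ} (c : Fin (m + 2) → Column) (M : Multiset ℕ) (hM : (lastL c).1 ∈ M) :
    (c 0).1 ∈ frontLabels c + M := by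
  cases m with
  | zero => exact Multiset.mem_add.2 (Or.inr hM)
  | succ m =>
    induction c using Fin.consCases with
    | _ x c =>
      rw [frontLabels_cons]
      simp

/-- In a sorted front, the first bottom label is a minimum, provided that the left bottom label of
the last piece is a lower bound of the remaining labels `M`. -/
theorem head_le {m : ℕ} (c : Fin (m + 2) → Column) (M : Multiset ℕ)
    (hM : ∀ y ∈ M, (lastL c).1 ≤ y) (hc : FrontSorted c) :
    ∀ y ∈ frontLabels c + M, (c 0).1 ≤ y := by
  induction m with
  | zero =>
    intro y hy
    exact hM y (by simpa [frontLabels] using hy)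
  | succ m ih =>
    induction c using Fin.consCases with
    | _ x c =>
      rw [frontSorted_cons] at hc
      intro y hy
      rw [frontLabels_cons, add_assoc, Multiset.mem_add] at hy
      rcases hy with hy | hy
      · have : y = x.1 ∨ y = x.2 := by simpa using hy
        rcases this with rfl | rfl
        · exact le_rfl
        · exact hc.1.le
      · exact hc.2.1.le.trans (ih c hM hc.2.2 y hy)

/-- The greedy count. The last two columns enter through a list `g c c'` of `k` of their labels,
which starts with the left bottom label, and a condition `F` which determines the other labels. The
labellings with a sorted front in which the list is increasing and whose front and listed labels
exhaust `S` are counted by always giving the minimum to the first bottom label, and any other label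
to the first top label. -/
theorem exists_finset_sortedFront (g : Column → Column → List ℕ) (F : Column → Column → Prop)
    (k : ℕ)
    (hg : ∀ c c', ∃ l, g c c' = c.1 :: l)
    (hk : ∀ l : List ℕ, l.length = k → ∃! p : Column × Column, g p.1 p.2 = l ∧ F p.1 p.2)
    (m : ℕ) (S : Finset ℕ) (hS : S.card = 2 * m + k) :
    ∃ X : Finset (Fin (m + 2) → Column), X.card = ∏ i ∈ Finset.range m, (2 * i + k + 1) ∧
      ∀ c, c ∈ X ↔ frontLabels c + (g (lastL c) (lastR c) : Multiset ℕ) = S.val ∧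
        FrontSorted c ∧ (g (lastL c) (lastR c)).Pairwise (· < ·) ∧ F (lastL c) (lastR c) := by
  induction m generalizing S with
  | zero =>
    obtain ⟨p, ⟨hp, hF⟩, hu⟩ := hk (S.sort (· ≤ ·)) (by simpa using hS)
    refine ⟨{![p.1, p.2]}, by simp, fun c => ?_⟩
    have hc : c = ![lastL c, lastR c] := by
      ext i <;> fin_cases i <;> rfl
    have hpw : (S.sort (· ≤ ·)).Pairwise (· < ·) := S.sortedLT_sort.pairwise
    have hfl : frontLabels c = 0 := by simp [frontLabels]
    rw [Finset.mem_singleton, hfl, zero_add (g (lastL c) (lastR c) : Multiset ℕ)]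
    constructor
    · rintro rfl
      change ((g p.1 p.2 : List ℕ) : Multiset ℕ) = S.val ∧ _ ∧ (g p.1 p.2).Pairwise _ ∧ F p.1 p.2
      rw [hp]
      exact ⟨S.sort_eq _, fun j => j.elim0, hpw, hF⟩
    · rintro ⟨h1, -, h3, h4⟩
      have : g (lastL c) (lastR c) = S.sort (· ≤ ·) := by
        refine List.Perm.eq_of_pairwise (le := (· < ·)) ?_ h3 hpw ?_
        · intro a b _ _ hab hba
          exact absurd hab hba.not_gt
        · rw [← Multiset.coe_eq_coe, h1, S.sort_eq]
      have := hu (lastL c, lastR c) ⟨this, h4⟩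
      rw [hc, ← this]
  | succ m ih =>
    have hne : S.Nonempty := by
      rw [← Finset.card_pos]; omega
    set b := S.min' hne with hb
    have hbS : b ∈ S := S.min'_mem hne
    have hX : ∀ t, ∃ X : Finset (Fin (m + 2) → Column), t ∈ S.erase b →
        X.card = ∏ i ∈ Finset.range m, (2 * i + k + 1) ∧
        ∀ c, c ∈ X ↔ frontLabels c + (g (lastL c) (lastR c) : Multiset ℕ) =
            ((S.erase b).erase t).val ∧
          FrontSorted c ∧ (g (lastL c) (lastR c)).Pairwise (· < ·) ∧ F (lastL c) (lastR c) := by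
      intro t
      by_cases ht : t ∈ S.erase b
      · obtain ⟨X, hX⟩ := ih ((S.erase b).erase t) (by
          rw [Finset.card_erase_of_mem ht, Finset.card_erase_of_mem hbS]; omega)
        exact ⟨X, fun _ => hX⟩
      · exact ⟨∅, fun h => absurd h ht⟩
    choose X hX using hX
    -- Prepend the column `(b, t)` to the labellings of the remaining labels, for each `t`.
    refine ⟨(S.erase b).biUnion fun t =>
        (X t).map ⟨_, Fin.cons_right_injective (α := fun _ => Column) (b, t)⟩,
      ?_, fun c => ?_⟩
    · rw [Finset.card_biUnion]
      · simp only [Finset.card_map]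
        rw [Finset.sum_congr rfl fun t ht => (hX t ht).1, Finset.sum_const,
          Finset.card_erase_of_mem hbS, Finset.prod_range_succ, hS, smul_eq_mul, mul_comm]
        congr 1
        omega
      · intro t _ t' _ htt'
        rw [Function.onFun, Finset.disjoint_left]
        intro c hc hc'
        simp only [Finset.mem_map, Function.Embedding.coeFn_mk] at hc hc'
        obtain ⟨d, -, rfl⟩ := hc
        obtain ⟨d', -, h⟩ := hc'
        have := congrFun h 0
        simp only [Fin.cons_zero, Prod.mk.injEq] at this
        exact htt' this.2.symm
    · induction c using Fin.consCases with
      | _ x c =>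
        have hval : ∀ t ∈ S.erase b, S.val = b ::ₘ t ::ₘ ((S.erase b).erase t).val := by
          intro t ht
          rw [Finset.erase_val, Multiset.cons_erase (by exact ht), Finset.erase_val,
            Multiset.cons_erase (by exact hbS)]
        rw [frontLabels_cons, lastL_cons, lastR_cons, frontSorted_cons]
        have hlab : ({x.1, x.2} : Multiset ℕ) + frontLabels c + (g (lastL c) (lastR c) : Multiset ℕ)
            = x.1 ::ₘ x.2 ::ₘ (frontLabels c + (g (lastL c) (lastR c) : Multiset ℕ)) := by
          simp [Multiset.insert_eq_cons]
        rw [hlab]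
        simp only [Finset.mem_biUnion, Finset.mem_map, Function.Embedding.coeFn_mk]
        obtain ⟨l, hl⟩ := hg (lastL c) (lastR c)
        constructor
        · rintro ⟨t, ht, d, hd, hdc⟩
          obtain ⟨rfl, rfl⟩ := Fin.cons_inj.1 hdc
          obtain ⟨h1, h2, h3⟩ := ((hX t ht).2 d).1 hd
          have hlt : ∀ y ∈ S.erase b, b < y := fun y hy =>
            S.min'_lt_of_mem_erase_min' hne hy
          refine ⟨by rw [h1]; exact (hval t ht).symm, ⟨hlt t ht, hlt _ ?_, h2⟩, h3⟩
          have := head_mem d (g (lastL d) (lastR d)) (by rw [hl]; simp)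
          rw [h1] at this
          exact Finset.mem_of_mem_erase this
        · rintro ⟨h1, ⟨h2, h3, h4⟩, h5, h6⟩
          have hmin := head_le c (g (lastL c) (lastR c)) (by
            rw [hl] at h5 ⊢
            intro y hy
            rcases List.mem_cons.1 (Multiset.mem_coe.1 hy) with rfl | hy
            · exact le_rfl
            · exact ((List.pairwise_cons.1 h5).1 y hy).le) h4
          have hxS : x.1 ∈ S := by
            rw [← Finset.mem_val, ← h1]; simp
          have hx2S : x.2 ∈ S := by
            rw [← Finset.mem_val, ← h1]; simp
          have hxb : x.1 = b := by
            refine le_antisymm ?_ (S.min'_le _ hxS)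
            have hbS' := hbS
            rw [← Finset.mem_val, ← h1, Multiset.mem_cons, Multiset.mem_cons] at hbS'
            rcases hbS' with h | h | h
            · exact h.ge
            · exact h ▸ h2.le
            · exact h3.le.trans (hmin _ h)
          have ht : x.2 ∈ S.erase b := Finset.mem_erase.2 ⟨hxb ▸ h2.ne', hx2S⟩
          refine ⟨x.2, ht, c, ((hX _ ht).2 c).2 ⟨?_, h4, h5, h6⟩, by rw [← hxb]⟩
          rw [hval _ ht, hxb] at h1
          simpa using h1

/-! ### Reductions of pieces -/

/-- The piece with given left and right columns. -/
def pieceOf (c c' : Column) : Piece := !![c.2, c'.2; c.1, c'.1]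

theorem reduction_apply (M : Piece) (i j : Fin 2) : reduction M i j =
    (Finset.univ.filter fun v : Fin 2 × Fin 2 => M v.1 v.2 ≤ M i j).card := rfl

/-- Reduction preserves and reflects the order of the labels, ties included. -/
theorem reduction_lt_reduction_iff (M : Piece) (i j i' j' : Fin 2) :
    reduction M i j < reduction M i' j' ↔ M i j < M i' j' := by
  have mono : ∀ {i j i' j'}, M i j ≤ M i' j' → reduction M i j ≤ reduction M i' j' := fun h => by
    rw [reduction_apply, reduction_apply]
    refine Finset.card_le_card fun v => ?_
    simp only [Finset.mem_filter, Finset.mem_univ, true_and]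
    exact fun hv => hv.trans h
  constructor
  · intro h
    by_contra! hle
    exact (mono hle).not_gt h
  · intro h
    rw [reduction_apply, reduction_apply]
    refine Finset.card_lt_card (Finset.ssubset_iff_of_subset ?_ |>.2 ⟨(i', j'), ?_, ?_⟩)
    · intro v
      simp only [Finset.mem_filter, Finset.mem_univ, true_and]
      exact fun hv => hv.trans h.le
    · simp
    · simpa using h

theorem reduction_eq_of_lt_iff {M X : Piece} (hX : reduction X = X)
    (h : ∀ i j i' j', M i j < M i' j' ↔ X i j < X i' j') : reduction M = X := by
  rw [← hX]
  ext i j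
  rw [reduction_apply, reduction_apply]
  refine congrArg Finset.card (Finset.filter_congr fun v _ => ?_)
  rw [← not_lt, h, not_lt]

theorem reduction_eq_iff {X : Piece} (hX : reduction X = X) (c c' : Column) :
    reduction (pieceOf c c') = X ↔
      ∀ i j i' j', pieceOf c c' i j < pieceOf c c' i' j' ↔ X i j < X i' j' :=
  ⟨fun h i j i' j' => by rw [← h, reduction_lt_reduction_iff], reduction_eq_of_lt_iff hX⟩

theorem reduction_eq_A₁_iff (c c' : Column) : reduction (pieceOf c c') = A₁ ↔
    [c.1, c'.1, c'.2, c.2].Pairwise (· < ·) := by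
  rw [reduction_eq_iff (by decide)]
  simp [Fin.forall_fin_two, pieceOf, A₁]
  omega

theorem reduction_eq_A₂_iff (c c' : Column) : reduction (pieceOf c c') = A₂ ↔
    [c.1, c'.1, c.2, c'.2].Pairwise (· < ·) := by
  rw [reduction_eq_iff (by decide)]
  simp [Fin.forall_fin_two, pieceOf, A₂]
  omega

theorem reduction_eq_A₃_iff (c c' : Column) : reduction (pieceOf c c') = A₃ ↔
    [c.1, c.2, c'.1, c'.2].Pairwise (· < ·) := by
  rw [reduction_eq_iff (by decide)]
  simp [Fin.forall_fin_two, pieceOf, A₃]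
  omega

theorem reduction_eq_B₁_iff (c c' : Column) : reduction (pieceOf c c') = B₁ ↔
    [c.1, c'.2, c'.1, c.2].Pairwise (· < ·) := by
  rw [reduction_eq_iff (by decide)]
  simp [Fin.forall_fin_two, pieceOf, B₁]
  omega

theorem reduction_eq_B₂_iff (c c' : Column) : reduction (pieceOf c c') = B₂ ↔
    [c.1, c'.2, c.2, c'.1].Pairwise (· < ·) := by
  rw [reduction_eq_iff (by decide)]
  simp [Fin.forall_fin_two, pieceOf, B₂]
  omega

theorem reduction_eq_B₃_iff (c c' : Column) : reduction (pieceOf c c') = B₃ ↔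
    [c.1, c.2, c'.2, c'.1].Pairwise (· < ·) := by
  rw [reduction_eq_iff (by decide)]
  simp [Fin.forall_fin_two, pieceOf, B₃]
  omega

theorem reduction_eq_B₄_iff (c c' : Column) : reduction (pieceOf c c') = B₄ ↔
    [c'.2, c.1, c.2, c'.1].Pairwise (· < ·) := by
  rw [reduction_eq_iff (by decide)]
  simp [Fin.forall_fin_two, pieceOf, B₄]
  omega

theorem reduction_eq_B₅_iff (c c' : Column) : reduction (pieceOf c c') = B₅ ↔
    [c'.2, c.1, c'.1, c.2].Pairwise (· < ·) := by
  rw [reduction_eq_iff (by decide)]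
  simp [Fin.forall_fin_two, pieceOf, B₅]
  omega

theorem reduction_eq_B₆_iff (c c' : Column) : reduction (pieceOf c c') = B₆ ↔
    [c'.2, c'.1, c.1, c.2].Pairwise (· < ·) := by
  rw [reduction_eq_iff (by decide)]
  simp [Fin.forall_fin_two, pieceOf, B₆]
  omega

/-! ### Counting labellings by their last piece -/

/-- The multiset of the labels of the last piece. -/
def endLabels {m : ℕ} (c : Fin (m + 2) → Column) : Multiset ℕ :=
  {(lastL c).1, (lastL c).2, (lastR c).1, (lastR c).2}

/-- The standard labellings of `m + 2` columns whose front is sorted and whose last piece reduces to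
an element of `T`. -/
def EndingIn (m : ℕ) (T : Set Piece) : Set (Fin (m + 2) → Column) :=
  {c | frontLabels c + endLabels c = (Finset.Icc 1 (2 * m + 4)).val ∧ FrontSorted c ∧
    reduction (pieceOf (lastL c) (lastR c)) ∈ T}

theorem endLabels_nodup {m : ℕ} {c : Fin (m + 2) → Column} {S : Finset ℕ}
    (h : frontLabels c + endLabels c = S.val) :
    [(lastL c).1, (lastL c).2, (lastR c).1, (lastR c).2].Nodup := by
  have h1 : (frontLabels c + endLabels c).Nodup := h ▸ S.nodup
  exact Multiset.coe_nodup.1 (Multiset.nodup_of_le (Multiset.le_add_left _ _) h1)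

theorem ncard_eq_card_mul_of_fibers {α ι : Type*} (E : Set α) (I : Finset ι) (N : ℕ) (f : α → ι)
    (hf : ∀ a ∈ E, f a ∈ I)
    (h : ∀ i ∈ I, ∃ X : Finset α, X.card = N ∧ ∀ a, a ∈ X ↔ a ∈ E ∧ f a = i) :
    E.ncard = I.card * N := by
  classical
  choose! X hcard hmem using h
  have hE : E = I.biUnion X := by
    ext a
    simp only [Finset.coe_biUnion, Set.mem_iUnion, Finset.mem_coe, exists_prop]
    constructor
    · exact fun ha => ⟨f a, hf a ha, (hmem _ (hf a ha) a).2 ⟨ha, rfl⟩⟩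
    · rintro ⟨i, hi, ha⟩
      exact ((hmem i hi a).1 ha).1
  rw [hE, Set.ncard_coe_finset, Finset.card_biUnion, Finset.sum_congr rfl hcard, Finset.sum_const,
    smul_eq_mul]
  intro i hi j hj hij
  rw [Function.onFun, Finset.disjoint_left]
  intro a ha ha'
  exact hij (((hmem i hi a).1 ha).2.symm.trans ((hmem j hj a).1 ha').2)

/-- The greedy count for a last piece with a prescribed order `g` of its labels, whose minimum is at
the bottom left; `p` recovers the two columns from the ordered labels. -/
theorem endingIn_ncard_of_order (g : Column → Column → List ℕ)
    (p : ℕ → ℕ → ℕ → ℕ → Column × Column) (X : Piece) (m : ℕ)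
    (hX : ∀ c c', reduction (pieceOf c c') = X ↔ (g c c').Pairwise (· < ·))
    (hg : ∀ c c', ∃ l, g c c' = c.1 :: l)
    (hperm : ∀ c c', (g c c').Perm [c.1, c.2, c'.1, c'.2])
    (hp : ∀ x y z w c c', g c c' = [x, y, z, w] ↔ (c, c') = p x y z w) :
    (EndingIn m {X}).ncard = ∏ i ∈ Finset.range m, (2 * i + 5) := by
  obtain ⟨Y, hY, hmem⟩ := exists_finset_sortedFront g (fun _ _ => True) 4 hg
    (fun l hl => by
      obtain ⟨x, y, z, w, rfl⟩ := List.length_eq_four.1 hl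
      exact ⟨p x y z w, ⟨(hp _ _ _ _ _ _).2 rfl, trivial⟩, fun q hq => (hp _ _ _ _ _ _).1 hq.1⟩)
    m (Finset.Icc 1 (2 * m + 4)) (by simp)
  rw [← hY, ← Set.ncard_coe_finset]
  congr 1
  ext c
  rw [Finset.mem_coe, hmem, Multiset.coe_eq_coe.2 (hperm _ _), and_true, ← hX]
  rfl

theorem endingIn_singleton_ncard (m : ℕ) {X : Piece}
    (hX : X ∈ ({A₁, A₂, A₃, B₁, B₂, B₃} : Set Piece)) :
    (EndingIn m {X}).ncard = ∏ i ∈ Finset.range m, (2 * i + 5) := by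
  rcases hX with rfl | rfl | rfl | rfl | rfl | rfl
  · refine endingIn_ncard_of_order _ (fun x y z w => ((x, w), (y, z))) _ m reduction_eq_A₁_iff
      (fun _ _ => ⟨_, rfl⟩) (fun c c' => ?_) (fun x y z w c c' => ?_)
    · simp only [List.perm_iff_count, List.count_cons, List.count_nil]
      omega
    · simp only [List.cons.injEq, Prod.ext_iff]
      tauto
  · refine endingIn_ncard_of_order _ (fun x y z w => ((x, z), (y, w))) _ m reduction_eq_A₂_iff
      (fun _ _ => ⟨_, rfl⟩) (fun c c' => ?_) (fun x y z w c c' => ?_)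
    · simp only [List.perm_iff_count, List.count_cons, List.count_nil]
      omega
    · simp only [List.cons.injEq, Prod.ext_iff]
      tauto
  · refine endingIn_ncard_of_order _ (fun x y z w => ((x, y), (z, w))) _ m reduction_eq_A₃_iff
      (fun _ _ => ⟨_, rfl⟩) (fun c c' => List.Perm.refl _) (fun x y z w c c' => ?_)
    simp only [List.cons.injEq, Prod.ext_iff]
    tauto
  · refine endingIn_ncard_of_order _ (fun x y z w => ((x, w), (z, y))) _ m reduction_eq_B₁_iff
      (fun _ _ => ⟨_, rfl⟩) (fun c c' => ?_) (fun x y z w c c' => ?_)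
    · simp only [List.perm_iff_count, List.count_cons, List.count_nil]
      omega
    · simp only [List.cons.injEq, Prod.ext_iff]
      tauto
  · refine endingIn_ncard_of_order _ (fun x y z w => ((x, z), (w, y))) _ m reduction_eq_B₂_iff
      (fun _ _ => ⟨_, rfl⟩) (fun c c' => ?_) (fun x y z w c c' => ?_)
    · simp only [List.perm_iff_count, List.count_cons, List.count_nil]
      omega
    · simp only [List.cons.injEq, Prod.ext_iff]
      tauto
  · refine endingIn_ncard_of_order _ (fun x y z w => ((x, y), (w, z))) _ m reduction_eq_B₃_iff
      (fun _ _ => ⟨_, rfl⟩) (fun c c' => ?_) (fun x y z w c c' => ?_)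
    · simp only [List.perm_iff_count, List.count_cons, List.count_nil]
      omega
    · simp only [List.cons.injEq, Prod.ext_iff]
      tauto

/-- The greedy count when the condition on the last piece only concerns the order `g` of its labels
other than the top right one `t`; for each value of `t`, `p` recovers the two columns from `t` and
the ordered labels. -/
theorem endingIn_ncard_of_order_free_top (g : Column → Column → List ℕ)
    (p : ℕ → ℕ → ℕ → ℕ → Column × Column) (T : Set Piece) (m : ℕ)
    (hT : ∀ c c' : Column, [c.1, c.2, c'.1, c'.2].Nodup →
      (reduction (pieceOf c c') ∈ T ↔ (g c c').Pairwise (· < ·)))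
    (hg : ∀ c c', ∃ l, g c c' = c.1 :: l)
    (hperm : ∀ c c', (c'.2 :: g c c').Perm [c.1, c.2, c'.1, c'.2])
    (hp : ∀ t x y z c c', g c c' = [x, y, z] ∧ c'.2 = t ↔ (c, c') = p t x y z) :
    (EndingIn m T).ncard = (2 * m + 4) * ∏ i ∈ Finset.range m, (2 * i + 4) := by
  have hlab : ∀ c : Fin (m + 2) → Column, frontLabels c + endLabels c =
      (lastR c).2 ::ₘ (frontLabels c + (g (lastL c) (lastR c) : Multiset ℕ)) := fun c => by
    rw [← Multiset.add_cons, Multiset.cons_coe, Multiset.coe_eq_coe.2 (hperm _ _)]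
    rfl
  have hcard := ncard_eq_card_mul_of_fibers (EndingIn m T) (Finset.Icc 1 (2 * m + 4))
    (∏ i ∈ Finset.range m, (2 * i + 4)) (fun c => (lastR c).2)
    (fun c hc => by
      rw [← Finset.mem_val, ← hc.1, hlab]
      exact Multiset.mem_cons_self _ _)
    (fun t ht => by
      obtain ⟨Y, hY, hmem⟩ := exists_finset_sortedFront g (fun _ c' => c'.2 = t) 3 hg
        (fun l hl => by
          obtain ⟨x, y, z, rfl⟩ := List.length_eq_three.1 hl
          exact ⟨p t x y z, (hp _ _ _ _ _ _).2 rfl, fun q hq => (hp _ _ _ _ _ _).1 hq⟩)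
        m ((Finset.Icc 1 (2 * m + 4)).erase t) (by
          rw [Finset.card_erase_of_mem ht, Nat.card_Icc]
          omega)
      refine ⟨Y, hY, fun c => ?_⟩
      have hS : (Finset.Icc 1 (2 * m + 4)).val =
          t ::ₘ ((Finset.Icc 1 (2 * m + 4)).erase t).val := by
        rw [Finset.erase_val, Multiset.cons_erase (by exact ht)]
      rw [hmem]
      constructor
      · rintro ⟨h1, h2, h3, h4⟩
        have h : frontLabels c + endLabels c = (Finset.Icc 1 (2 * m + 4)).val := by
          rw [hlab, h1, h4, hS]
        exact ⟨⟨h, h2, (hT _ _ (endLabels_nodup h)).2 h3⟩, h4⟩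
      · rintro ⟨⟨h1, h2, h3⟩, h4⟩
        refine ⟨?_, h2, (hT _ _ (endLabels_nodup h1)).1 h3, h4⟩
        rw [hlab, hS, h4] at h1
        exact (Multiset.cons_inj_right _).1 h1)
  rw [hcard, Nat.card_Icc, Nat.add_sub_cancel]

theorem endingIn_A₃_B₂_B₃_B₄_ncard (m : ℕ) : (EndingIn m {A₃, B₂, B₃, B₄}).ncard =
    (2 * m + 4) * ∏ i ∈ Finset.range m, (2 * i + 4) := by
  refine endingIn_ncard_of_order_free_top (fun c c' => [c.1, c.2, c'.1])
    (fun t x y z => ((x, y), (z, t))) _ m (fun c c' h => ?_)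
    (fun _ _ => ⟨_, rfl⟩) (fun c c' => ?_) (fun t x y z c c' => ?_)
  · simp only [Set.mem_insert_iff, Set.mem_singleton_iff, reduction_eq_A₃_iff,
      reduction_eq_B₂_iff, reduction_eq_B₃_iff, reduction_eq_B₄_iff]
    simp at h ⊢
    omega
  · simp only [List.perm_iff_count, List.count_cons, List.count_nil]
    omega
  · simp only [List.cons.injEq, Prod.ext_iff]
    tauto

theorem endingIn_A₁_A₂_B₁_B₅_ncard (m : ℕ) : (EndingIn m {A₁, A₂, B₁, B₅}).ncard =
    (2 * m + 4) * ∏ i ∈ Finset.range m, (2 * i + 4) := by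
  refine endingIn_ncard_of_order_free_top (fun c c' => [c.1, c'.1, c.2])
    (fun t x y z => ((x, z), (y, t))) _ m (fun c c' h => ?_)
    (fun _ _ => ⟨_, rfl⟩) (fun c c' => ?_) (fun t x y z c c' => ?_)
  · simp only [Set.mem_insert_iff, Set.mem_singleton_iff, reduction_eq_A₁_iff,
      reduction_eq_A₂_iff, reduction_eq_B₁_iff, reduction_eq_B₅_iff]
    simp at h ⊢
    omega
  · simp only [List.perm_iff_count, List.count_cons, List.count_nil]
    omega
  · simp only [List.cons.injEq, Prod.ext_iff]
    tauto

/-- For a given last column with `t' < b'`, the only condition left on the last piece is that its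
left column be increasing. The possible last columns correspond to the pairs of labels. -/
theorem endingIn_B_ncard (m : ℕ) : (EndingIn m {B₁, B₂, B₃, B₄, B₅, B₆}).ncard =
    (2 * m + 4).choose 2 * ∏ i ∈ Finset.range m, (2 * i + 3) := by
  have hT : ∀ c c' : Column, [c.1, c.2, c'.1, c'.2].Nodup →
      (reduction (pieceOf c c') ∈ ({B₁, B₂, B₃, B₄, B₅, B₆} : Set Piece) ↔
        [c.1, c.2].Pairwise (· < ·) ∧ c'.2 < c'.1) := fun c c' h => by
    simp only [Set.mem_insert_iff, Set.mem_singleton_iff, reduction_eq_B₁_iff,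
      reduction_eq_B₂_iff, reduction_eq_B₃_iff, reduction_eq_B₄_iff, reduction_eq_B₅_iff,
      reduction_eq_B₆_iff]
    simp at h ⊢
    omega
  have hlab : ∀ c : Fin (m + 2) → Column, frontLabels c + endLabels c =
      (lastR c).2 ::ₘ (lastR c).1 ::ₘ
        (frontLabels c + ([(lastL c).1, (lastL c).2] : Multiset ℕ)) := fun c => by
    rw [← Multiset.add_cons, ← Multiset.add_cons, Multiset.cons_coe, Multiset.cons_coe]
    congr 1
    refine Multiset.coe_eq_coe.2 ?_
    simp only [List.perm_iff_count, List.count_cons, List.count_nil]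
    omega
  have hcard := ncard_eq_card_mul_of_fibers (EndingIn m {B₁, B₂, B₃, B₄, B₅, B₆})
    ((Finset.Icc 1 (2 * m + 4)).powersetCard 2)
    (∏ i ∈ Finset.range m, (2 * i + 3)) (fun c => {(lastR c).2, (lastR c).1})
    (fun c hc => by
      have hlt := ((hT _ _ (endLabels_nodup hc.1)).1 hc.2.2).2
      rw [Finset.mem_powersetCard]
      refine ⟨?_, Finset.card_pair hlt.ne⟩
      intro y hy
      rw [← Finset.mem_val, ← hc.1, hlab]
      simp only [Finset.mem_insert, Finset.mem_singleton] at hy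
      rcases hy with rfl | rfl <;> simp)
    (fun s hs => by
      obtain ⟨hs, hs2⟩ := Finset.mem_powersetCard.1 hs
      obtain ⟨x, y, hxy, rfl⟩ : ∃ x y, x < y ∧ s = {x, y} := by
        obtain ⟨x, y, hne, rfl⟩ := Finset.card_eq_two.1 hs2
        rcases hne.lt_or_gt with h | h
        · exact ⟨x, y, h, rfl⟩
        · exact ⟨y, x, h, Finset.pair_comm _ _⟩
      have hx : x ∈ Finset.Icc 1 (2 * m + 4) := hs (by simp)
      have hy : y ∈ (Finset.Icc 1 (2 * m + 4)).erase x :=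
        Finset.mem_erase.2 ⟨hxy.ne', hs (by simp)⟩
      obtain ⟨Y, hY, hmem⟩ := exists_finset_sortedFront (fun c _ => [c.1, c.2])
        (fun _ c' => c' = (y, x)) 2 (fun _ _ => ⟨_, rfl⟩)
        (fun l hl => by
          obtain ⟨a, b, rfl⟩ := List.length_eq_two.1 hl
          refine ⟨((a, b), (y, x)), ⟨rfl, rfl⟩, fun q hq => ?_⟩
          simp only [List.cons.injEq, Prod.ext_iff] at hq ⊢
          tauto)
        m (((Finset.Icc 1 (2 * m + 4)).erase x).erase y) (by
          rw [Finset.card_erase_of_mem hy, Finset.card_erase_of_mem hx, Nat.card_Icc]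
          omega)
      refine ⟨Y, hY, fun c => ?_⟩
      have hS : (Finset.Icc 1 (2 * m + 4)).val =
          x ::ₘ y ::ₘ (((Finset.Icc 1 (2 * m + 4)).erase x).erase y).val := by
        rw [Finset.erase_val, Multiset.cons_erase (by exact hy), Finset.erase_val,
          Multiset.cons_erase (by exact hx)]
      rw [hmem]
      constructor
      · rintro ⟨h1, h2, h3, h4⟩
        have h : frontLabels c + endLabels c = (Finset.Icc 1 (2 * m + 4)).val := by
          rw [hlab, h1, h4, hS]
        refine ⟨⟨h, h2, (hT _ _ (endLabels_nodup h)).2 ⟨h3, ?_⟩⟩, ?_⟩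
        · rw [h4]; exact hxy
        · simp [h4]
      · rintro ⟨⟨h1, h2, h3⟩, h4⟩
        obtain ⟨h5, h6⟩ := (hT _ _ (endLabels_nodup h1)).1 h3
        have h7 : lastR c = (y, x) := by
          have e1 : (lastR c).2 ∈ ({x, y} : Finset ℕ) := h4 ▸ by simp
          have e2 : (lastR c).1 ∈ ({x, y} : Finset ℕ) := h4 ▸ by simp
          simp only [Finset.mem_insert, Finset.mem_singleton] at e1 e2
          rw [Prod.ext_iff]
          dsimp only
          omega
        refine ⟨?_, h2, h5, h7⟩
        rw [hlab, hS, h7] at h1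
        exact (Multiset.cons_inj_right _).1 ((Multiset.cons_inj_right _).1 h1))
  rw [hcard, Finset.card_powersetCard, Nat.card_Icc, Nat.add_sub_cancel]

theorem endingIn_finite (m : ℕ) (T : Set Piece) : (EndingIn m T).Finite := by
  refine (Set.Finite.pi' fun _ : Fin (m + 2) =>
    (Set.finite_Icc 1 (2 * m + 4)).prod (Set.finite_Icc 1 (2 * m + 4))).subset ?_
  intro c hc j
  have key : ∀ y ∈ frontLabels c + endLabels c, y ∈ Set.Icc 1 (2 * m + 4) := fun y hy => by
    rw [hc.1] at hy
    simpa using hy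
  have hj : (c j).1 ∈ frontLabels c + endLabels c ∧ (c j).2 ∈ frontLabels c + endLabels c := by
    simp only [frontLabels, endLabels, Multiset.mem_add, Multiset.mem_sum, Finset.mem_univ,
      true_and]
    induction j using Fin.lastCases with
    | last => simp [lastR]
    | cast j =>
      induction j using Fin.lastCases with
      | last => simp [lastL]
      | cast j => exact ⟨Or.inl ⟨j, by simp⟩, Or.inl ⟨j, by simp⟩⟩
  exact ⟨key _ hj.1, key _ hj.2⟩

/-- The labellings are partitioned by the reductions of their last pieces. -/
theorem endingIn_insert_ncard (m : ℕ) {X : Piece} {T : Set Piece} (hX : X ∉ T) :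
    (EndingIn m (insert X T)).ncard = (EndingIn m {X}).ncard + (EndingIn m T).ncard := by
  rw [← Set.ncard_union_eq ?_ (endingIn_finite m _) (endingIn_finite m _)]
  · congr 1
    ext c
    simp only [EndingIn, Set.mem_union, Set.mem_ofPred_eq, Set.mem_insert_iff,
      Set.mem_singleton_iff]
    tauto
  · rw [Set.disjoint_left]
    rintro c ⟨-, -, h⟩ ⟨-, -, h'⟩
    exact hX (Set.mem_singleton_iff.1 h ▸ h')

/-! ### Puzzles as sequences of columns -/

/-- The two-row matrix with given columns. -/
def ofColumns {n : ℕ} (c : Fin (n + 1) → Column) : Matrix (Fin 2) (Fin (n + 1)) ℕ :=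
  Matrix.of ![fun j => (c j).2, fun j => (c j).1]

theorem ofColumns_injective {n : ℕ} : Function.Injective (ofColumns (n := n)) := by
  intro c d h
  funext j
  exact Prod.ext (congrFun (congrFun h 1) j) (congrFun (congrFun h 0) j)

theorem ofColumns_surjective {n : ℕ} : Function.Surjective (ofColumns (n := n)) := by
  intro α
  refine ⟨fun j => (α 1 j, α 0 j), ?_⟩
  ext i j
  fin_cases i <;> rfl

theorem isStandardPuzzle_iff_map_val {n : ℕ} (α : Matrix (Fin 2) (Fin (n + 1)) ℕ) :
    IsStandardPuzzle α ↔ (Finset.univ : Finset (Fin 2 × Fin (n + 1))).val.map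
      (fun v => α v.1 v.2) = (Finset.Icc 1 (2 * n + 2)).val := by
  unfold IsStandardPuzzle
  constructor
  · intro h
    have himg : (Finset.univ : Finset (Fin 2 × Fin (n + 1))).image (fun v => α v.1 v.2) =
        Finset.Icc 1 (2 * n + 2) := by
      rw [← Finset.coe_inj]
      simpa using h
    have hcard : (Finset.univ : Finset (Fin 2 × Fin (n + 1))).card =
        ((Finset.univ : Finset (Fin 2 × Fin (n + 1))).image (fun v => α v.1 v.2)).card := by
      rw [himg]
      simp
      ring
    rw [← himg, Finset.image_val_of_injOn (Finset.card_image_iff.1 hcard.symm)]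
  · intro h
    ext y
    have := congrArg (y ∈ ·) h
    simpa using this

theorem map_labels_ofColumns {m : ℕ} (c : Fin (m + 2) → Column) :
    (Finset.univ : Finset (Fin 2 × Fin (m + 2))).val.map (fun v => ofColumns c v.1 v.2) =
      frontLabels c + endLabels c := by
  have h : ∀ a b : ℕ, ({a, b} : Multiset ℕ) = {a} + {b} := fun a b => rfl
  calc _ = ∑ v : Fin 2 × Fin (m + 2), {ofColumns c v.1 v.2} := by
        rw [Finset.sum, ← Multiset.sum_map_singleton (Multiset.map _ _), Multiset.map_map]
        rfl
    _ = ∑ j : Fin (m + 2), {(c j).1, (c j).2} := by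
        rw [Fintype.sum_prod_type_right]
        refine Finset.sum_congr rfl fun j _ => ?_
        rw [Fin.sum_univ_two, h, add_comm]
        rfl
    _ = _ := by
        rw [Fin.sum_univ_castSucc, Fin.sum_univ_castSucc, add_assoc]
        rfl

theorem reduction_mem_A_iff (c c' : Column) (h : [c.1, c.2, c'.1, c'.2].Nodup) :
    reduction (pieceOf c c') ∈ ({A₁, A₂, A₃} : Set Piece) ↔
      c.1 < c.2 ∧ c.1 < c'.1 ∧ c'.1 < c'.2 := by
  simp only [Set.mem_insert_iff, Set.mem_singleton_iff, reduction_eq_A₁_iff,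
    reduction_eq_A₂_iff, reduction_eq_A₃_iff]
  simp at h ⊢
  omega

/-- A piece `B` whose left column is increasing upwards and whose right column is decreasing upwards
can only be the last piece of a puzzle supported by `A₁, A₂, A₃, B`. -/
theorem s_eq_ncard_endingIn (m : ℕ) (B : Piece)
    (hB : ∀ c c', reduction (pieceOf c c') = B → c.1 < c.2 ∧ c'.2 < c'.1) :
    s (m + 1) ({A₁, A₂, A₃} ∪ {B}) = (EndingIn m ({A₁, A₂, A₃} ∪ {B})).ncard := by
  rw [s, ← Set.ncard_image_of_injective _ ofColumns_injective]
  congr 1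
  ext α
  obtain ⟨c, rfl⟩ := ofColumns_surjective α
  rw [ofColumns_injective.mem_set_image]
  change IsStandardPuzzle _ ∧ IsSupport _ _ ↔ _ ∧ _ ∧ _
  rw [isStandardPuzzle_iff_map_val, map_labels_ofColumns]
  refine and_congr_right fun hlab => ?_
  have hnd : ∀ k : Fin (m + 1),
      [(c k.castSucc).1, (c k.castSucc).2, (c k.succ).1, (c k.succ).2].Nodup := by
    have hinj : Function.Injective fun v : Fin 2 × Fin (m + 2) => ofColumns c v.1 v.2 := by
      have hn : ((Finset.univ : Finset (Fin 2 × Fin (m + 2))).val.map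
          (fun v => ofColumns c v.1 v.2)).Nodup := by
        rw [map_labels_ofColumns, hlab]
        exact Finset.nodup _
      intro v w h
      exact Multiset.inj_on_of_nodup_map hn v (Finset.mem_univ_val v) w
        (Finset.mem_univ_val w) h
    intro k
    have hk : k.castSucc ≠ k.succ := Fin.castSucc_lt_succ.ne
    have hl : [((1, k.castSucc) : Fin 2 × Fin (m + 2)), (0, k.castSucc), (1, k.succ),
        (0, k.succ)].Nodup := by
      simp [hk]
    exact hl.map hinj
  have hpiece : ∀ k : Fin (m + 1), reduction (pieceAt (ofColumns c) k) =
      reduction (pieceOf (c k.castSucc) (c k.succ)) := fun _ => rfl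
  -- Hence the piece before an admissible one has an increasing right column, so it is not `B`.
  have hleft : ∀ k : Fin (m + 1),
      reduction (pieceOf (c k.castSucc) (c k.succ)) ∈ ({A₁, A₂, A₃} ∪ {B} : Set Piece) →
      (c k.castSucc).1 < (c k.castSucc).2 := by
    rintro k (h | h)
    · exact ((reduction_mem_A_iff _ _ (hnd k)).1 h).1
    · exact (hB _ _ h).1
  simp only [IsSupport, hpiece]
  rw [Fin.forall_fin_succ']
  constructor
  · rintro ⟨h1, h2⟩
    refine ⟨fun j => ?_, h2⟩
    have hnext : (c j.succ.castSucc).1 < (c j.succ.castSucc).2 := by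
      refine hleft _ ?_
      induction j.succ using Fin.lastCases with
      | last => exact h2
      | cast i => exact h1 i
    rcases h1 j with h | h
    · have := (reduction_mem_A_iff _ _ (hnd _)).1 h
      exact ⟨this.1, this.2.1⟩
    · exact absurd (hB _ _ h).2 hnext.not_gt
  · rintro ⟨h1, h2⟩
    refine ⟨fun j => Or.inl ((reduction_mem_A_iff _ _ (hnd _)).2 ⟨(h1 j).1, (h1 j).2, ?_⟩), h2⟩
    change (c j.succ.castSucc).1 < (c j.succ.castSucc).2
    induction j.succ using Fin.lastCases with
    | last => exact hleft _ h2
    | cast i => exact (h1 i).1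

/-! ### Closed forms of the products -/

theorem three_mul_prod (m : ℕ) :
    3 * ∏ i ∈ Finset.range m, (2 * i + 5) = (2 * m + 3)‼ := by
  induction m with
  | zero => rfl
  | succ m ih =>
    rw [Finset.prod_range_succ, show 2 * (m + 1) + 3 = (2 * m + 3) + 2 by ring,
      Nat.doubleFactorial_add_two, ← ih]
    ring

theorem mul_prod_even (m : ℕ) :
    (2 * m + 4) * ∏ i ∈ Finset.range m, (2 * i + 4) = 2 ^ (m + 1) * (m + 2)! := by
  induction m with
  | zero => rfl
  | succ m ih =>
    rw [Finset.prod_range_succ, Nat.factorial_succ (m + 2), pow_succ]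
    linear_combination (2 * m + 6) * ih

theorem mul_prod_odd (m : ℕ) :
    (2 * m + 3) * ∏ i ∈ Finset.range m, (2 * i + 3) = (2 * m + 3)‼ := by
  induction m with
  | zero => rfl
  | succ m ih =>
    rw [Finset.prod_range_succ, show 2 * (m + 1) + 3 = (2 * m + 3) + 2 by ring,
      Nat.doubleFactorial_add_two, ← ih]
    ring

theorem choose_two_mul_prod (m : ℕ) :
    (2 * m + 4).choose 2 * ∏ i ∈ Finset.range m, (2 * i + 3) = (m + 2) * (2 * m + 3)‼ := by
  have h : (2 * m + 4).choose 2 = (m + 2) * (2 * m + 3) := by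
    rw [Nat.choose_two_right, show 2 * m + 4 - 1 = 2 * m + 3 by omega,
      show (2 * m + 4) * (2 * m + 3) = (m + 2) * (2 * m + 3) * 2 by ring,
      Nat.mul_div_cancel _ two_pos]
  rw [h, mul_assoc, mul_prod_odd]

end StandardPuzzle

open StandardPuzzle in
theorem mainTheorem8 (n : ℕ) (hn : 1 ≤ n) (P : Set StandardPuzzle.Piece)
    (hP : P = {StandardPuzzle.A₁, StandardPuzzle.A₂, StandardPuzzle.A₃}) :
    ((StandardPuzzle.s n (P ∪ {StandardPuzzle.B₁}) : ℚ) = 4 / 3 * ((2 * n + 1)‼ : ℕ) ∧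
      (StandardPuzzle.s n (P ∪ {StandardPuzzle.B₂}) : ℚ) = 4 / 3 * ((2 * n + 1)‼ : ℕ) ∧
      (StandardPuzzle.s n (P ∪ {StandardPuzzle.B₃}) : ℚ) = 4 / 3 * ((2 * n + 1)‼ : ℕ)) ∧
    (StandardPuzzle.s n (P ∪ {StandardPuzzle.B₄}) = 2 ^ n * (n + 1)! ∧
      StandardPuzzle.s n (P ∪ {StandardPuzzle.B₅}) = 2 ^ n * (n + 1)!) ∧
    (StandardPuzzle.s n (P ∪ {StandardPuzzle.B₆}) : ℤ) =
      (n + 3) * ((2 * n + 1)‼ : ℕ) - ((2 * n + 2)‼ : ℕ) := by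
  subst hP
  obtain ⟨m, rfl⟩ : ∃ m, n = m + 1 := ⟨n - 1, by omega⟩
  have hs : ∀ B ∈ ({B₁, B₂, B₃, B₄, B₅, B₆} : Set Piece),
      s (m + 1) ({A₁, A₂, A₃} ∪ {B}) = (EndingIn m {A₁}).ncard + (EndingIn m {A₂}).ncard +
        (EndingIn m {A₃}).ncard + (EndingIn m {B}).ncard := by
    intro B hB
    have hA : A₁ ∉ ({A₂, A₃, B} : Set Piece) ∧ A₂ ∉ ({A₃, B} : Set Piece) ∧
        A₃ ∉ ({B} : Set Piece) := by
      simp only [Set.mem_insert_iff, Set.mem_singleton_iff]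
      rcases hB with rfl | rfl | rfl | rfl | rfl | rfl <;> decide
    rw [s_eq_ncard_endingIn m B ?_]
    · rw [show ({A₁, A₂, A₃} ∪ {B} : Set Piece) = {A₁, A₂, A₃, B} by ext; simp; tauto,
        endingIn_insert_ncard m hA.1, endingIn_insert_ncard m hA.2.1,
        endingIn_insert_ncard m hA.2.2, add_assoc, add_assoc]
    · intro c c' h
      rcases hB with rfl | rfl | rfl | rfl | rfl | rfl
      · rw [reduction_eq_B₁_iff] at h; simp at h; omega
      · rw [reduction_eq_B₂_iff] at h; simp at h; omega
      · rw [reduction_eq_B₃_iff] at h; simp at h; omega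
      · rw [reduction_eq_B₄_iff] at h; simp at h; omega
      · rw [reduction_eq_B₅_iff] at h; simp at h; omega
      · rw [reduction_eq_B₆_iff] at h; simp at h; omega
  -- Each of the three counts below is a sum of numbers of labellings with a given last piece, among
  -- which those for `A₁, A₂, A₃, B₁, B₂, B₃` are all equal to `(2 m + 3)‼ / 3`.
  have h4 := endingIn_A₃_B₂_B₃_B₄_ncard m
  rw [endingIn_insert_ncard m (by decide), endingIn_insert_ncard m (by decide),
    endingIn_insert_ncard m (by decide), mul_prod_even] at h4
  have h5 := endingIn_A₁_A₂_B₁_B₅_ncard m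
  rw [endingIn_insert_ncard m (by decide), endingIn_insert_ncard m (by decide),
    endingIn_insert_ncard m (by decide), mul_prod_even] at h5
  have h6 := endingIn_B_ncard m
  rw [endingIn_insert_ncard m (by decide), endingIn_insert_ncard m (by decide),
    endingIn_insert_ncard m (by decide), endingIn_insert_ncard m (by decide),
    endingIn_insert_ncard m (by decide), choose_two_mul_prod] at h6
  have h3 := three_mul_prod m
  rw [hs B₁ (by simp), hs B₂ (by simp), hs B₃ (by simp), hs B₄ (by simp), hs B₅ (by simp),
    hs B₆ (by simp)]
  have hdf : (2 * (m + 1) + 2)‼ = 2 * (2 ^ (m + 1) * (m + 2)!) := by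
    rw [show 2 * (m + 1) + 2 = 2 * (m + 2) by ring, Nat.doubleFactorial_two_mul]
    ring
  rw [hdf, show 2 * (m + 1) + 1 = 2 * m + 3 by ring, ← h3]
  rw [← h3] at h6
  have e : ∀ X ∈ ({A₁, A₂, A₃, B₁, B₂, B₃} : Set Piece), _ := fun X hX =>
    endingIn_singleton_ncard m hX
  rw [e A₁ (by simp), e A₂ (by simp), e A₃ (by simp), e B₁ (by simp), e B₂ (by simp),
    e B₃ (by simp)] at *
  generalize ∏ i ∈ Finset.range m, (2 * i + 5) = a at *
  refine ⟨⟨?_, ?_, ?_⟩, ⟨?_, ?_⟩, ?_⟩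
  · push_cast; ring
  · push_cast; ring
  · push_cast; ring
  · change _ = 2 ^ (m + 1) * (m + 2)!
    omega
  · change _ = 2 ^ (m + 1) * (m + 2)!
    omega
  · zify at h4 h5 h6
    push_cast
    linear_combination h6 - h4 - h5
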